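/- Let $(M, g)$ be a relativistic spacetime: $M$ is a connected (Hausdorff) smooth four-dimensional manifold and $g$ is a smooth metric on $M$ of Lorentz signature $(1,3)$, that is, every tangent space has a $g$-orthogonal basis $\xi_1,\dots,\xi_4$ with $g(\xi_1,\xi_1)=1$ and $g(\xi_i,\xi_i)=-1$ for $i=2,3,4$. A tangent vector $v$ is timelike if $g(v,v)>0$ and causal if $g(v,v)\ge 0$. Two continuous timelike vector fields $\tau,\hat\tau$ on $M$ are co-oriented if $g(\tau,\hat\tau)>0$ everywhere. Assume that $(M,g)$ is temporally orientable (it has a continuous timelike vector field), and fix a temporal orientation $\mathcal{T}$, i.e. a co-orientation class of continuous timelike vector fields. A nonzero causal vector $v$ at $x$ is future directed if $g(\tau(x),v)>0$ for every $\tau\in\mathcal{T}$. A curve $\gamma:[a,b]\to M$, $a<b$, is always understood to be smooth (the restriction of a smooth map defined on an open interval containing $[a,b]$); it is timelike if all its tangent vectors $\gamma'(s)$, $s\in[a,b]$, are timelike, and a future-directed timelike curve if, in addition, they are all future directed. It is a curve from $p$ to $q$ if $\gamma(a)=p$ and $\gamma(b)=q$. Write $p\ll q$ if there is a future-directed timelike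 curve from $p$ to $q$. The length (elapsed proper time) of a timelike curve $\gamma:[a,b]\to M$ is $$|\gamma|=\int_a^b g(\gamma'(s),\gamma'(s))^{1/2}\,ds .$$ **Proposition.** Let $p$ and $q$ be points of $M$ such that $p\ll q$. Then for every $\epsilon>0$ there is a future-directed timelike curve $\gamma$ from $p$ to $q$ with $|\gamma|<\epsilon$. But there is no future-directed timelike curve from $p$ to $q$ with length $0$; indeed every timelike curve $\gamma:[a,b]\to M$ has non-zero length. -/

import Mathlib

open scoped Manifold ContDiff

noncomputable section

namespace Spacetime

/-- The time component dominates: coordinate form of the reversed Cauchy–Schwarz inequality in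
signature `(1, 3)`, for a timelike vector `t` and a causal vector `v`. -/
theorem coord_pos_iff {t₀ t₁ t₂ t₃ v₀ v₁ v₂ v₃ : ℝ}
    (ht : 0 < t₀ * t₀ - t₁ * t₁ - t₂ * t₂ - t₃ * t₃)
    (hv : 0 ≤ v₀ * v₀ - v₁ * v₁ - v₂ * v₂ - v₃ * v₃) (hv₀ : v₀ ≠ 0) :
    0 < t₀ * v₀ - t₁ * v₁ - t₂ * v₂ - t₃ * v₃ ↔ 0 < t₀ * v₀ := by
  have hcs : (t₁ * v₁ + t₂ * v₂ + t₃ * v₃) ^ 2 ≤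
      (t₁ * t₁ + t₂ * t₂ + t₃ * t₃) * (v₁ * v₁ + v₂ * v₂ + v₃ * v₃) := by
    nlinarith [sq_nonneg (t₁ * v₂ - t₂ * v₁), sq_nonneg (t₁ * v₃ - t₃ * v₁),
      sq_nonneg (t₂ * v₃ - t₃ * v₂)]
  have hlt : (t₁ * v₁ + t₂ * v₂ + t₃ * v₃) ^ 2 < (t₀ * v₀) ^ 2 := by
    have hv2 : 0 < v₀ * v₀ := mul_self_pos.2 hv₀
    have h1 : (t₁ * t₁ + t₂ * t₂ + t₃ * t₃) * (v₁ * v₁ + v₂ * v₂ + v₃ * v₃) ≤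
        (t₁ * t₁ + t₂ * t₂ + t₃ * t₃) * (v₀ * v₀) := by
      apply mul_le_mul_of_nonneg_left
      · linarith
      · nlinarith [mul_self_nonneg t₁, mul_self_nonneg t₂, mul_self_nonneg t₃]
    nlinarith
  constructor
  · intro h
    by_contra hc
    nlinarith
  · intro h
    have := abs_lt_of_sq_lt_sq' hlt h.le
    linarith [this.2]

/-- A bilinear form in coordinates with respect to an orthogonal basis of signature `(1, 3)`. -/
theorem form_eq_coord {V : Type*} [AddCommGroup V] [Module ℝ V] (B : V →ₗ[ℝ] V →ₗ[ℝ] ℝ)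
    (e : Module.Basis (Fin 4) ℝ V)
    (he : ∀ i j : Fin 4, B (e i) (e j) = if i = j then (if i = 0 then 1 else -1) else 0)
    (a b : V) : B a b = e.repr a 0 * e.repr b 0 - e.repr a 1 * e.repr b 1
      - e.repr a 2 * e.repr b 2 - e.repr a 3 * e.repr b 3 := by
  conv_lhs => rw [← e.sum_repr a, ← e.sum_repr b]
  simp only [Fin.sum_univ_four, map_add, map_smul, LinearMap.add_apply, LinearMap.smul_apply, he,
    smul_eq_mul]
  simp
  ring

variable (M : Type*) [TopologicalSpace M] [ChartedSpace (EuclideanSpace ℝ (Fin 4)) M]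
  [IsManifold (𝓡 4) ∞ M]

/-- A smooth metric of Lorentz signature `(1, 3)` on the smooth 4-manifold `M`. -/
structure LorentzMetric where
  /-- The metric as a bilinear form on each tangent space. -/
  form (x : M) : TangentSpace (𝓡 4) x →L[ℝ] TangentSpace (𝓡 4) x →L[ℝ] ℝ
  symm (x : M) (v w : TangentSpace (𝓡 4) x) : form x v w = form x w v
  /-- Every tangent space has an orthogonal basis with squared lengths `+1, -1, -1, -1`. -/
  signature (x : M) : ∃ e : Module.Basis (Fin 4) ℝ (TangentSpace (𝓡 4) x), ∀ i j : Fin 4,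
    form x (e i) (e j) = if i = j then (if i = 0 then 1 else -1) else 0
  /-- The metric is a smooth section of the bundle of bilinear forms. -/
  contMDiff : ContMDiff (𝓡 4)
    ((𝓡 4).prod 𝓘(ℝ, EuclideanSpace ℝ (Fin 4) →L[ℝ] EuclideanSpace ℝ (Fin 4) →L[ℝ] ℝ)) ∞
    (fun x ↦ Bundle.TotalSpace.mk'
      (EuclideanSpace ℝ (Fin 4) →L[ℝ] EuclideanSpace ℝ (Fin 4) →L[ℝ] ℝ)
      (E := fun y : M ↦ TangentSpace (𝓡 4) y →L[ℝ] TangentSpace (𝓡 4) y →L[ℝ] ℝ) x (form x))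

variable {M}

/-- A tangent vector `v` at `x` is timelike if `g(v, v) > 0`. -/
def IsTimelike (g : LorentzMetric M) (x : M) (v : TangentSpace (𝓡 4) x) : Prop :=
  0 < g.form x v v

/-- A tangent vector `v` at `x` is causal if `g(v, v) ≥ 0`. -/
def IsCausal (g : LorentzMetric M) (x : M) (v : TangentSpace (𝓡 4) x) : Prop :=
  0 ≤ g.form x v v

/-- If `t` and `u` are co-oriented timelike vectors, then a causal vector has positive product
with `t` iff it has positive product with `u`. -/
theorem form_pos_congr (g : LorentzMetric M) (x : M) {t u v : TangentSpace (𝓡 4) x}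
    (ht : IsTimelike g x t) (hu : IsTimelike g x u) (hv : IsCausal g x v)
    (htu : 0 < g.form x t u) (htv : 0 < g.form x t v) : 0 < g.form x u v := by
  obtain ⟨e, he⟩ := g.signature x
  have key : ∀ a b : TangentSpace (𝓡 4) x, g.form x a b =
      e.repr a 0 * e.repr b 0 - e.repr a 1 * e.repr b 1 - e.repr a 2 * e.repr b 2
        - e.repr a 3 * e.repr b 3 := by
    intro a b
    exact form_eq_coord (g.form x).toLinearMap₁₂ e he a b
  unfold IsTimelike at ht hu
  unfold IsCausal at hv
  rw [key] at ht hu hv htu htv ⊢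
  have hne : ∀ w : Fin 4 → ℝ, 0 ≤ w 0 * w 0 - w 1 * w 1 - w 2 * w 2 - w 3 * w 3 → w 0 = 0 →
      w 1 = 0 ∧ w 2 = 0 ∧ w 3 = 0 := by
    intro w hw h0
    rw [h0] at hw
    refine ⟨?_, ?_, ?_⟩ <;> nlinarith [mul_self_nonneg (w 1), mul_self_nonneg (w 2),
      mul_self_nonneg (w 3)]
  have hv₀ : e.repr v 0 ≠ 0 := by
    intro h0
    obtain ⟨h1, h2, h3⟩ := hne _ hv h0
    rw [h0, h1, h2, h3] at htv
    simp at htv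
  have hu₀ : e.repr u 0 ≠ 0 := by
    intro h0
    obtain ⟨h1, h2, h3⟩ := hne _ hu.le h0
    rw [h0, h1, h2, h3] at hu
    simp at hu
  rw [coord_pos_iff hu hv hv₀]
  rw [coord_pos_iff ht hv hv₀] at htv
  rw [coord_pos_iff ht hu.le hu₀] at htu
  by_contra hc
  have := mul_pos htu htv
  nlinarith [mul_self_nonneg (e.repr t 0)]

/-- A continuous timelike vector field on `M`. -/
structure TimelikeField (g : LorentzMetric M) where
  /-- The value of the vector field at a point. -/
  field (x : M) : TangentSpace (𝓡 4) x
  continuous : Continuous fun x ↦ (⟨x, field x⟩ : TangentBundle (𝓡 4) M)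
  timelike (x : M) : IsTimelike g x (field x)

/-- Co-orientation of continuous timelike vector fields: `g(τ, σ) > 0` everywhere. -/
instance coOriented (g : LorentzMetric M) : Setoid (TimelikeField g) where
  r τ σ := ∀ x, 0 < g.form x (τ.field x) (σ.field x)
  iseqv :=
    { refl := fun τ x ↦ τ.timelike x
      symm := fun {τ σ} h x ↦ by rw [g.symm]; exact h x
      trans := fun {τ σ ρ} h h' x ↦
        form_pos_congr g x (σ.timelike x) (τ.timelike x) (ρ.timelike x).le
          (by rw [g.symm]; exact h x) (h' x) }

/-- A temporal orientation: a co-orientation class of continuous timelike vector fields. -/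
def TemporalOrientation (g : LorentzMetric M) : Type _ := Quotient (coOriented g)

/-- A nonzero causal vector `v` at `x` is future directed if `g(τ, v) > 0` for the fields `τ` in
the temporal orientation. -/
def IsFutureDirected (g : LorentzMetric M) (T : TemporalOrientation g) (x : M)
    (v : TangentSpace (𝓡 4) x) : Prop :=
  v ≠ 0 ∧ IsCausal g x v ∧ ∀ τ : TimelikeField g, Quotient.mk (coOriented g) τ = T →
    0 < g.form x (τ.field x) v

/-- Being future directed may be tested on any one field in the temporal orientation. -/
theorem isFutureDirected_mk_iff (g : LorentzMetric M) (τ : TimelikeField g) (x : M)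
    (v : TangentSpace (𝓡 4) x) :
    IsFutureDirected g (Quotient.mk (coOriented g) τ) x v ↔
      IsCausal g x v ∧ 0 < g.form x (τ.field x) v := by
  constructor
  · rintro ⟨-, hc, h⟩
    exact ⟨hc, h τ rfl⟩
  · rintro ⟨hc, h⟩
    refine ⟨?_, hc, fun σ hσ ↦ ?_⟩
    · rintro rfl
      simp at h
    · have hστ : ∀ y, 0 < g.form y (σ.field y) (τ.field y) := Quotient.exact hσ
      exact form_pos_congr g x (τ.timelike x) (σ.timelike x) hc
        (by rw [g.symm]; exact hστ x) h

/-- The restriction of `γ` to the interval `I` is a smooth curve: it is the restriction to `I` of a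
smooth map defined on an open interval containing `I`. (Values of `γ` outside `I` are
irrelevant.) -/
def IsSmoothCurve (γ : ℝ → M) (I : Set ℝ) : Prop :=
  ∃ J : Set ℝ, IsOpen J ∧ J.OrdConnected ∧ I ⊆ J ∧
    ∃ γ' : ℝ → M, ContMDiffOn 𝓘(ℝ, ℝ) (𝓡 4) ∞ γ' J ∧ Set.EqOn γ' γ I

/-- The tangent vector at the parameter `s` of the curve `γ` with domain the interval `I`
(one-sided at the endpoints of `I`). -/
def tangent (γ : ℝ → M) (I : Set ℝ) (s : ℝ) : TangentSpace (𝓡 4) (γ s) :=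
  mfderivWithin 𝓘(ℝ, ℝ) (𝓡 4) γ I s (1 : ℝ)

/-- `γ : [a, b] → M`, with `a < b`, is a timelike curve. -/
def IsTimelikeCurve (g : LorentzMetric M) (γ : ℝ → M) (a b : ℝ) : Prop :=
  a < b ∧ IsSmoothCurve γ (Set.Icc a b) ∧
    ∀ s ∈ Set.Icc a b, IsTimelike g (γ s) (tangent γ (Set.Icc a b) s)

/-- `γ : [a, b] → M`, with `a < b`, is a future-directed timelike curve. -/
def IsFutureTimelikeCurve (g : LorentzMetric M) (T : TemporalOrientation g) (γ : ℝ → M)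
    (a b : ℝ) : Prop :=
  IsTimelikeCurve g γ a b ∧
    ∀ s ∈ Set.Icc a b, IsFutureDirected g T (γ s) (tangent γ (Set.Icc a b) s)

/-- `γ : [a, b] → M` is a future-directed timelike curve from `p` to `q`. -/
def IsFutureTimelikeCurveFromTo (g : LorentzMetric M) (T : TemporalOrientation g) (p q : M)
    (γ : ℝ → M) (a b : ℝ) : Prop :=
  IsFutureTimelikeCurve g T γ a b ∧ γ a = p ∧ γ b = q

/-- The chronological relation `p ≪ q`. -/
def Chronological (g : LorentzMetric M) (T : TemporalOrientation g) (p q : M) : Prop :=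
  ∃ (γ : ℝ → M) (a b : ℝ), IsFutureTimelikeCurveFromTo g T p q γ a b

/-- The elapsed proper time (length) `∫ g(ξ, ξ)^(1/2) ds` of `γ : [a, b] → M`, where `ξ` is the
tangent field of `γ`. -/
def properTime (g : LorentzMetric M) (γ : ℝ → M) (a b : ℝ) : ℝ :=
  ∫ s in a..b, Real.sqrt
    (g.form (γ s) (tangent γ (Set.Icc a b) s) (tangent γ (Set.Icc a b) s))

end Spacetime

end

open scoped Manifold ContDiff

namespace Spacetime

open Set Filter Topology

/-! A timelike vector `v` is the average of the circle `v + cos θ • f₁ + sin θ • f₂`, where `f₁` and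
`f₂` are spacelike, of equal length, and orthogonal to `v` and to each other. When that length is
close to the length of `v`, the whole circle is future directed and almost null. So a curve with
velocity near `v` can be replaced, in a chart, by a tight helix around it: the displacement is
small, but the velocity runs round the circle and hardly any proper time elapses.

`exists_rapid_oscillation` builds the displacement, cut off so that the endpoints stay fixed.
`exists_disc_chartLift` shows that the velocities met while the cut-off function rises from 0 to 1,
which fill the disc, remain future directed timelike, with uniform tolerance for errors.
`exists_local_shortening` combines the two, and `exists_shortening` applies the result along a
subdivision of `[a, b]`.

Length zero is impossible because the integrand is continuous and positive. -/

/-! ### Rapid oscillation in a normed space. -/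

/-- A smooth function with small values and compact support in `(c, d)`, whose derivative rotates
in the plane of `e₁` and `e₂`. -/
theorem exists_rapid_oscillation {E : Type*} [NormedAddCommGroup E] [NormedSpace ℝ E] (e₁ e₂ : E)
    {c d μ δ : ℝ} (hμ : 0 < μ) (hcd : 2 * μ < d - c) (hδ : 0 < δ) :
    ∃ v : ℝ → E, ContDiff ℝ ∞ v ∧ tsupport v ⊆ Ioo c d ∧ ∃ p q : ℝ → ℝ, ∀ s,
      p s ^ 2 + q s ^ 2 ≤ 1 ∧ (s ∈ Icc (c + μ) (d - μ) → p s ^ 2 + q s ^ 2 = 1) ∧ ‖v s‖ < δ ∧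
      ‖deriv v s - (p s • e₁ + q s • e₂)‖ < δ := by
  -- The inner ball is `[c + μ, d - μ]`; the outer one ends `μ / 2` short of `c` and `d`.
  let f : ContDiffBump ((c + d) / 2) := ⟨(d - c) / 2 - μ, (d - c) / 2 - μ / 2, by linarith,
    by linarith⟩
  have hf : ContDiff ℝ ∞ f := f.contDiff
  obtain ⟨C, hC⟩ : ∃ C, ∀ s, ‖deriv f s‖ ≤ C :=
    (hf.continuous_deriv (by simp)).bounded_above_of_compact_support f.hasCompactSupport.deriv
  have hC0 : 0 ≤ C := (norm_nonneg _).trans (hC 0)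
  set A : ℝ := ‖e₁‖ + ‖e₂‖
  have hA0 : 0 ≤ A := by positivity
  -- The function will be `k⁻¹ • f • r`. Its size is at most `A / k`, and the error in its
  -- derivative, `k⁻¹ • f' • r`, at most `C * A / k`; this frequency makes both less than `δ`.
  obtain ⟨k, hk0, hk⟩ : ∃ k : ℝ, 0 < k ∧ (1 + C) * A < k * δ := by
    refine ⟨((1 + C) * A + 1) / δ, by positivity, ?_⟩
    rw [div_mul_cancel₀ _ hδ.ne']
    linarith
  have hsmall : ∀ m : ℝ, m ≤ 1 + C → k⁻¹ * (m * A) < δ := by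
    intro m hm
    rw [inv_mul_lt_iff₀ hk0]
    nlinarith
  let r : ℝ → E := fun s ↦ Real.sin (k * s) • e₁ - Real.cos (k * s) • e₂
  have hrn : ∀ s, ‖r s‖ ≤ A := by
    intro s
    refine (norm_sub_le _ _).trans ?_
    rw [norm_smul, norm_smul]
    have h1 := Real.abs_sin_le_one (k * s)
    have h2 := Real.abs_cos_le_one (k * s)
    exact add_le_add (mul_le_of_le_one_left (norm_nonneg _) h1)
      (mul_le_of_le_one_left (norm_nonneg _) h2)
  have hr : ContDiff ℝ ∞ r := by fun_prop
  let r' : ℝ → E := fun s ↦ Real.cos (k * s) • e₁ + Real.sin (k * s) • e₂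
  have hrd : ∀ s, HasDerivAt r (k • r' s) s := by
    intro s
    have hl : HasDerivAt (fun s ↦ k * s) k s := by simpa using (hasDerivAt_id s).const_mul k
    convert! (hl.sin.smul_const e₁).sub (hl.cos.smul_const e₂) using 1
    simp only [r', smul_add, smul_smul, neg_mul, neg_smul, sub_neg_eq_add]
    rw [mul_comm k (Real.cos _), mul_comm k (Real.sin _)]
  refine ⟨fun s ↦ k⁻¹ • (f s • r s), contDiff_const.smul (hf.smul hr), ?_,
    fun s ↦ f s * Real.cos (k * s), fun s ↦ f s * Real.sin (k * s), ?_⟩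
  · have h1 : tsupport (fun s ↦ k⁻¹ • (f s • r s)) ⊆ tsupport f := by
      apply closure_mono
      intro s hs hs'
      exact hs (by simp [hs'])
    refine h1.trans ?_
    rw [f.tsupport_eq, Real.closedBall_eq_Icc]
    exact Icc_subset_Ioo (by simp only [f]; linarith) (by simp only [f]; linarith)
  · intro s
    have hpq : (f s * Real.cos (k * s)) ^ 2 + (f s * Real.sin (k * s)) ^ 2 = f s ^ 2 := by
      rw [mul_pow, mul_pow, ← mul_add, Real.cos_sq_add_sin_sq, mul_one]
    refine ⟨?_, fun hs ↦ ?_, ?_, ?_⟩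
    · rw [hpq]
      exact pow_le_one₀ f.nonneg f.le_one
    · rw [hpq, f.one_of_mem_closedBall, one_pow]
      rw [Real.closedBall_eq_Icc]
      exact ⟨by simp only [f]; linarith [hs.1], by simp only [f]; linarith [hs.2]⟩
    · rw [norm_smul, norm_smul, Real.norm_of_nonneg f.nonneg, norm_inv, Real.norm_of_nonneg hk0.le]
      refine lt_of_le_of_lt ?_ (hsmall 1 (by linarith))
      have := f.le_one (x := s)
      have := f.nonneg (x := s)
      gcongr
      exact hrn s
    · have hd : HasDerivAt (fun s ↦ k⁻¹ • (f s • r s))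
          (k⁻¹ • (f s • (k • r' s) + deriv f s • r s)) s :=
        (((hf.differentiable (by simp)) s).hasDerivAt.smul (hrd s)).const_smul k⁻¹
      rw [hd.deriv]
      have : k⁻¹ • (f s • (k • r' s) + deriv f s • r s)
          - ((f s * Real.cos (k * s)) • e₁ + (f s * Real.sin (k * s)) • e₂) =
          k⁻¹ • (deriv f s • r s) := by
        rw [mul_smul, mul_smul, ← smul_add]
        change _ - f s • r' s = _
        rw [smul_add, smul_comm (f s) k, inv_smul_smul₀ hk0.ne', add_sub_cancel_left]
      rw [this, norm_smul, norm_smul, norm_inv, Real.norm_of_nonneg hk0.le]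
      refine lt_of_le_of_lt ?_ (hsmall C (by linarith))
      gcongr
      · exact hC s
      · exact hrn s

/-! ### Velocities in the tangent bundle. -/

variable {M : Type*} [TopologicalSpace M] [ChartedSpace (EuclideanSpace ℝ (Fin 4)) M]

/-- The velocity of a curve, as an element of the tangent bundle. -/
noncomputable def velocity (γ : ℝ → M) (s : ℝ) : TangentBundle (𝓡 4) M :=
  tangentMap 𝓘(ℝ, ℝ) (𝓡 4) γ ⟨s, (1 : ℝ)⟩

theorem velocity_congr {γ σ : ℝ → M} {s : ℝ} (h : γ =ᶠ[𝓝 s] σ) : velocity γ s = velocity σ s := by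
  have h1 : γ s = σ s := h.self_of_nhds
  have h2 := h.mfderiv_eq (I := 𝓘(ℝ, ℝ)) (I' := 𝓡 4)
  unfold velocity tangentMap
  ext
  · exact h1
  · exact heq_of_eq (congrArg (fun L ↦ L (1 : ℝ)) h2)

/-- The tangent of a curve on `[a, b]` is the velocity of any smooth extension. -/
theorem mk_tangent_eq_velocity {γ σ : ℝ → M} {J : Set ℝ} {a b : ℝ} (hab : a < b) (hJ : IsOpen J)
    (hsub : Icc a b ⊆ J) (hσ : ContMDiffOn 𝓘(ℝ, ℝ) (𝓡 4) ∞ σ J) (h : EqOn σ γ (Icc a b)) {s : ℝ}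
    (hs : s ∈ Icc a b) :
    (⟨γ s, tangent γ (Icc a b) s⟩ : TangentBundle (𝓡 4) M) = velocity σ s := by
  have hd : MDifferentiableAt 𝓘(ℝ, ℝ) (𝓡 4) σ s :=
    (hσ.contMDiffAt (hJ.mem_nhds (hsub hs))).mdifferentiableAt (by simp)
  have hu : UniqueMDiffWithinAt 𝓘(ℝ, ℝ) (Icc a b) s :=
    (uniqueDiffOn_Icc hab s hs).uniqueMDiffWithinAt
  have h1 := mfderivWithin_congr (I := 𝓘(ℝ, ℝ)) (I' := 𝓡 4) (fun x hx ↦ (h hx).symm) (h hs).symm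
  rw [mfderivWithin_eq_mfderiv hu hd] at h1
  unfold velocity tangentMap
  ext
  · exact (h hs).symm
  · exact heq_of_eq (congrArg (fun L ↦ L (1 : ℝ)) h1)

/-- The derivative of the inverse of the chart at `x`, as a map into the tangent bundle. -/
noncomputable def chartLift (x : M) (z : EuclideanSpace ℝ (Fin 4) × EuclideanSpace ℝ (Fin 4)) :
    TangentBundle (𝓡 4) M :=
  tangentMap 𝓘(ℝ, EuclideanSpace ℝ (Fin 4)) (𝓡 4) (extChartAt (𝓡 4) x).symm ⟨z.1, z.2⟩

variable [IsManifold (𝓡 4) ∞ M]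

/-! ### Orthogonal spacelike pairs. -/

/-- Any vector `w` in `ℝ³` has two nonzero orthogonal vectors, orthogonal to each other. -/
theorem exists_orthogonal_coord (w₁ w₂ w₃ : ℝ) : ∃ a₁ a₂ a₃ b₁ b₂ b₃ : ℝ,
    w₁ * a₁ + w₂ * a₂ + w₃ * a₃ = 0 ∧ w₁ * b₁ + w₂ * b₂ + w₃ * b₃ = 0 ∧
    a₁ * b₁ + a₂ * b₂ + a₃ * b₃ = 0 ∧ 0 < a₁ * a₁ + a₂ * a₂ + a₃ * a₃ ∧
    0 < b₁ * b₁ + b₂ * b₂ + b₃ * b₃ := by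
  by_cases h : w₁ * w₁ + w₂ * w₂ = 0
  · obtain rfl : w₁ = 0 := by nlinarith [mul_self_nonneg w₁, mul_self_nonneg w₂]
    obtain rfl : w₂ = 0 := by nlinarith [mul_self_nonneg w₂]
    exact ⟨1, 0, 0, 0, 1, 0, by simp⟩
  · have h' : 0 < w₁ * w₁ + w₂ * w₂ :=
      lt_of_le_of_ne (add_nonneg (mul_self_nonneg _) (mul_self_nonneg _)) (Ne.symm h)
    -- The second vector is the cross product of `w` with the first.
    refine ⟨-w₂, w₁, 0, -(w₁ * w₃), -(w₂ * w₃), w₁ * w₁ + w₂ * w₂, by ring, by ring, by ring,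
      by linarith, ?_⟩
    have := mul_pos h' h'
    nlinarith [mul_self_nonneg (w₁ * w₃), mul_self_nonneg (w₂ * w₃)]

/-- A timelike vector `v` has two orthogonal spacelike vectors of any prescribed length, orthogonal
to each other. -/
theorem exists_orthogonal_pair (g : LorentzMetric M) (x : M) (v : TangentSpace (𝓡 4) x) {N : ℝ}
    (hN : 0 ≤ N) : ∃ f₁ f₂ : TangentSpace (𝓡 4) x, g.form x v f₁ = 0 ∧ g.form x v f₂ = 0 ∧
      g.form x f₁ f₂ = 0 ∧ g.form x f₁ f₁ = -N ∧ g.form x f₂ f₂ = -N := by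
  obtain ⟨e, he⟩ := g.signature x
  have key : ∀ a b : TangentSpace (𝓡 4) x, g.form x a b =
      e.repr a 0 * e.repr b 0 - e.repr a 1 * e.repr b 1 - e.repr a 2 * e.repr b 2
        - e.repr a 3 * e.repr b 3 := by
    intro a b
    exact form_eq_coord (g.form x).toLinearMap₁₂ e he a b
  obtain ⟨a₁, a₂, a₃, b₁, b₂, b₃, h1, h2, h3, ha, hb⟩ :=
    exists_orthogonal_coord (e.repr v 1) (e.repr v 2) (e.repr v 3)
  have hr : ∀ w : Fin 4 → ℝ, ∀ i, e.repr (e.equivFun.symm w) i = w i := by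
    intro w i
    rw [← e.equivFun_apply, LinearEquiv.apply_symm_apply]
  have hs : ∀ S : ℝ, 0 < S → √(N / S) * √(N / S) * S = N := by
    intro S hS
    rw [Real.mul_self_sqrt (by positivity), div_mul_cancel₀ _ hS.ne']
  have hsa := hs _ ha
  have hsb := hs _ hb
  set α := √(N / (a₁ * a₁ + a₂ * a₂ + a₃ * a₃))
  set β := √(N / (b₁ * b₁ + b₂ * b₂ + b₃ * b₃))
  -- With time component 0, orthogonality to `v` involves only the spatial part of `v`.
  refine ⟨e.equivFun.symm ![0, α * a₁, α * a₂, α * a₃],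
    e.equivFun.symm ![0, β * b₁, β * b₂, β * b₃], ?_, ?_, ?_, ?_, ?_⟩ <;>
    simp only [key, hr, Matrix.cons_val]
  · linear_combination (-α) * h1
  · linear_combination (-β) * h2
  · linear_combination (-α * β) * h3
  · linear_combination -hsa
  · linear_combination -hsb

/-! ### Continuity of velocities, chart lifts and the metric. -/

theorem continuousOn_velocity {γ : ℝ → M} {J : Set ℝ} (hJ : IsOpen J)
    (hγ : ContMDiffOn 𝓘(ℝ, ℝ) (𝓡 4) ∞ γ J) : ContinuousOn (velocity γ) J := by
  have e : ∀ s ∈ J, velocity γ s =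
      tangentMapWithin 𝓘(ℝ, ℝ) (𝓡 4) γ J (⟨s, (1 : ℝ)⟩ : TangentBundle 𝓘(ℝ, ℝ) ℝ) := by
    intro s hs
    have hd : MDifferentiableAt 𝓘(ℝ, ℝ) (𝓡 4) γ s :=
      (hγ.contMDiffAt (hJ.mem_nhds hs)).mdifferentiableAt (by simp)
    have hu : UniqueMDiffWithinAt 𝓘(ℝ, ℝ) J s := hJ.uniqueMDiffOn s hs
    simp only [velocity, tangentMap, tangentMapWithin, mfderivWithin_eq_mfderiv hu hd]
  have h1 := hγ.continuousOn_tangentMapWithin (by simp) hJ.uniqueMDiffOn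
  have h2 : Continuous fun s : ℝ ↦ (⟨s, (1 : ℝ)⟩ : TangentBundle 𝓘(ℝ, ℝ) ℝ) :=
    (tangentBundleModelSpaceHomeomorph 𝓘(ℝ, ℝ)).symm.continuous.comp
      (continuous_id.prodMk continuous_const)
  have h3 := h1.comp h2.continuousOn (s := J) (fun s hs ↦ hs)
  exact h3.congr e

theorem continuousOn_chartLift (x : M) :
    ContinuousOn (chartLift x) ((extChartAt (𝓡 4) x).target ×ˢ univ) := by
  have hO : IsOpen (extChartAt (𝓡 4) x).target := isOpen_extChartAt_target x
  have hγ := contMDiffOn_extChartAt_symm (I := 𝓡 4) (n := ∞) x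
  have e : ∀ z ∈ (extChartAt (𝓡 4) x).target ×ˢ (univ : Set (EuclideanSpace ℝ (Fin 4))),
      chartLift x z = tangentMapWithin (𝓡 4) (𝓡 4) (extChartAt (𝓡 4) x).symm
        (extChartAt (𝓡 4) x).target
        (⟨z.1, z.2⟩ : TangentBundle (𝓡 4) (EuclideanSpace ℝ (Fin 4))) := by
    intro z hz
    have hd : MDifferentiableAt (𝓡 4) (𝓡 4) (extChartAt (𝓡 4) x).symm z.1 :=
      (hγ.contMDiffAt (hO.mem_nhds hz.1)).mdifferentiableAt (by simp)
    have hu : UniqueMDiffWithinAt (𝓡 4) (extChartAt (𝓡 4) x).target z.1 :=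
      hO.uniqueMDiffOn z.1 hz.1
    simp only [chartLift, tangentMap, tangentMapWithin, mfderivWithin_eq_mfderiv hu hd]
  have h1 := hγ.continuousOn_tangentMapWithin (by simp) hO.uniqueMDiffOn
  have h2 : Continuous fun z : EuclideanSpace ℝ (Fin 4) × EuclideanSpace ℝ (Fin 4) ↦
      (⟨z.1, z.2⟩ : TangentBundle (𝓡 4) (EuclideanSpace ℝ (Fin 4))) :=
    (tangentBundleModelSpaceHomeomorph (𝓡 4)).symm.continuous
  have h3 := h1.comp h2.continuousOn (s := (extChartAt (𝓡 4) x).target ×ˢ univ) (fun s hs ↦ hs.1)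
  exact h3.congr e

/-- The velocity of a curve given by its coordinates in the chart at `x`. -/
theorem velocity_extChartAt_symm_comp (x : M) {u : ℝ → EuclideanSpace ℝ (Fin 4)} {s : ℝ}
    (hs : u s ∈ (extChartAt (𝓡 4) x).target) (hu : DifferentiableAt ℝ u s) :
    velocity (fun r ↦ (extChartAt (𝓡 4) x).symm (u r)) s = chartLift x (u s, deriv u s) := by
  have hO : IsOpen (extChartAt (𝓡 4) x).target := isOpen_extChartAt_target x
  have hγ := (contMDiffOn_extChartAt_symm (I := 𝓡 4) (n := ∞) x).contMDiffAt (hO.mem_nhds hs)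
  have := tangentMap_comp_at (⟨s, (1 : ℝ)⟩ : TangentBundle 𝓘(ℝ, ℝ) ℝ)
    (hγ.mdifferentiableAt (by simp)) hu.mdifferentiableAt
  refine this.trans ?_
  unfold chartLift
  congr 1
  ext
  · rfl
  · simp only [tangentMap, mfderiv_eq_fderiv]
    exact heq_of_eq (fderiv_apply_one_eq_deriv (𝕜 := ℝ) (f := u) (x := s))

/-- Every tangent vector over the chart domain comes from a vector in coordinates. -/
theorem surjective_mfderiv_extChartAt_symm (x : M) {y : EuclideanSpace ℝ (Fin 4)}
    (hy : y ∈ (extChartAt (𝓡 4) x).target) : Function.Surjective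
      (mfderiv 𝓘(ℝ, EuclideanSpace ℝ (Fin 4)) (𝓡 4) (extChartAt (𝓡 4) x).symm y) := by
  have h := isInvertible_mfderivWithin_extChartAt_symm hy
  rw [ModelWithCorners.range_eq_univ, mfderivWithin_univ] at h
  exact h.bijective.surjective

theorem continuous_form (g : LorentzMetric M)
    (X Y : ∀ v : TangentBundle (𝓡 4) M, TangentSpace (𝓡 4) v.proj)
    (hX : Continuous fun v ↦ (⟨v.proj, X v⟩ : TangentBundle (𝓡 4) M))
    (hY : Continuous fun v ↦ (⟨v.proj, Y v⟩ : TangentBundle (𝓡 4) M)) :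
    Continuous fun v ↦ g.form v.proj (X v) (Y v) := by
  have hp : ContMDiff (𝓡 4).tangent (𝓡 4) 0
      (fun v : TangentBundle (𝓡 4) M ↦ v.proj) :=
    contMDiff_zero_iff.2 (FiberBundle.continuous_proj _ _)
  have hg : ContMDiff (𝓡 4).tangent _ 0 _ := (g.contMDiff.of_le (by simp)).comp hp
  have h := ContMDiff.clm_bundle_apply₂ (IB := 𝓡 4) (F₃ := ℝ) (E₃ := Bundle.Trivial M ℝ)
    hg (contMDiff_zero_iff.2 hX) (contMDiff_zero_iff.2 hY)
  exact ((Bundle.Trivial.homeomorphProd M ℝ).continuous.comp h.continuous).snd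

/-- The squared length of a tangent vector. -/
noncomputable def sqNorm (g : LorentzMetric M) (v : TangentBundle (𝓡 4) M) : ℝ :=
  g.form v.proj v.snd v.snd

theorem continuous_sqNorm (g : LorentzMetric M) : Continuous (sqNorm g) :=
  continuous_form g (fun v ↦ v.snd) (fun v ↦ v.snd) continuous_id continuous_id

/-- The timelike vectors that are future directed for `τ`. -/
def futureTimelike (g : LorentzMetric M) (τ : TimelikeField g) : Set (TangentBundle (𝓡 4) M) :=
  {v | 0 < sqNorm g v ∧ 0 < g.form v.proj (τ.field v.proj) v.snd}

theorem isOpen_futureTimelike (g : LorentzMetric M) (τ : TimelikeField g) :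
    IsOpen (futureTimelike g τ) :=
  (isOpen_lt continuous_const (continuous_sqNorm g)).inter
    (isOpen_lt continuous_const (continuous_form g (fun v ↦ τ.field v.proj) (fun v ↦ v.snd)
      (τ.continuous.comp (FiberBundle.continuous_proj _ _)) continuous_id))

/-! ### Discs of timelike vectors with almost null boundary. -/

/-- Only `p ^ 2 + q ^ 2` enters, so the squared length is constant on circles. This is why two
spacelike directions are used: a smooth oscillation along a single one would have to pass through
the long vector `v` itself. -/
theorem form_add_smul_self (g : LorentzMetric M) {x : M} {v f₁ f₂ : TangentSpace (𝓡 4) x} {m : ℝ}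
    (h1 : g.form x v f₁ = 0) (h2 : g.form x v f₂ = 0) (h3 : g.form x f₁ f₂ = 0)
    (h4 : g.form x f₁ f₁ = -m) (h5 : g.form x f₂ f₂ = -m) (p q : ℝ) :
    g.form x (v + (p • f₁ + q • f₂)) (v + (p • f₁ + q • f₂)) =
      g.form x v v - (p ^ 2 + q ^ 2) * m := by
  have h1' := h1
  have h2' := h2
  have h3' := h3
  rw [g.symm] at h1' h2' h3'
  simp only [map_add, map_smul, add_apply, smul_apply,
    smul_eq_mul, h1, h2, h3, h4, h5, h1', h2', h3']
  ring

theorem form_self_add_smul (g : LorentzMetric M) {x : M} {v f₁ f₂ : TangentSpace (𝓡 4) x}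
    (h1 : g.form x v f₁ = 0) (h2 : g.form x v f₂ = 0) (p q : ℝ) :
    g.form x v (v + (p • f₁ + q • f₂)) = g.form x v v := by
  simp [h1, h2]

theorem isCompact_disc : IsCompact {r : ℝ × ℝ | r.1 ^ 2 + r.2 ^ 2 ≤ 1} := by
  refine (isCompact_Icc.prod isCompact_Icc :
    IsCompact (Icc (-1 : ℝ) 1 ×ˢ Icc (-1 : ℝ) 1)).of_isClosed_subset
    (isClosed_le (by fun_prop) continuous_const) fun r hr ↦ ?_
  have hr' : r.1 ^ 2 + r.2 ^ 2 ≤ 1 := hr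
  exact ⟨abs_le.1 ((sq_le_one_iff_abs_le_one _).1 (by nlinarith [sq_nonneg r.2])),
    abs_le.1 ((sq_le_one_iff_abs_le_one _).1 (by nlinarith [sq_nonneg r.1]))⟩

/-- Near a future directed timelike vector, in a chart, there is a disc of vectors which stay
future directed and timelike and are almost null on the boundary circle. -/
theorem exists_disc_chartLift (g : LorentzMetric M) (τ : TimelikeField g) (x : M)
    {y₀ w₀ : EuclideanSpace ℝ (Fin 4)} (hy : y₀ ∈ (extChartAt (𝓡 4) x).target)
    (h : chartLift x (y₀, w₀) ∈ futureTimelike g τ) {κ : ℝ} (hκ : 0 < κ) :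
    ∃ δ > 0, ∃ C : ℝ, ∃ e₁ e₂ : EuclideanSpace ℝ (Fin 4), ∀ y w, ∀ p q : ℝ,
      p ^ 2 + q ^ 2 ≤ 1 → ‖y - y₀‖ < δ → ‖w - (w₀ + (p • e₁ + q • e₂))‖ < δ →
      y ∈ (extChartAt (𝓡 4) x).target ∧ chartLift x (y, w) ∈ futureTimelike g τ ∧
      sqNorm g (chartLift x (y, w)) < C ∧
      (p ^ 2 + q ^ 2 = 1 → sqNorm g (chartLift x (y, w)) < κ) := by
  let A : EuclideanSpace ℝ (Fin 4) →L[ℝ]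
      TangentSpace (𝓡 4) ((extChartAt (𝓡 4) x).symm y₀) :=
    mfderiv 𝓘(ℝ, EuclideanSpace ℝ (Fin 4)) (𝓡 4) (extChartAt (𝓡 4) x).symm y₀
  set N := g.form _ (A w₀) (A w₀) with hN
  obtain ⟨h0, hτ⟩ : 0 < N ∧ 0 < g.form _ (τ.field _) (A w₀) := h
  -- `ρ` is the squared length on the unit circle, since `N - (N - ρ) = ρ`; `ρ ≤ N` makes the
  -- prescribed length `N - ρ` admissible.
  obtain ⟨ρ, hρ, hρκ, hρN⟩ : ∃ ρ : ℝ, 0 < ρ ∧ ρ < κ ∧ ρ ≤ N :=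
    ⟨min (κ / 2) N, by positivity, (min_le_left _ _).trans_lt (by linarith), min_le_right _ _⟩
  obtain ⟨f₁, f₂, h1, h2, h3, h4, h5⟩ :=
    exists_orthogonal_pair g _ (A w₀) (N := N - ρ) (by linarith)
  have hsurj : Function.Surjective A := surjective_mfderiv_extChartAt_symm x hy
  obtain ⟨e₁, rfl⟩ := hsurj f₁
  obtain ⟨e₂, rfl⟩ := hsurj f₂
  have hAadd : ∀ p q : ℝ, A (w₀ + (p • e₁ + q • e₂)) = A w₀ + (p • A e₁ + q • A e₂) := by
    intro p q
    simp only [map_add, map_smul]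
  have hsq : ∀ p q : ℝ, sqNorm g (chartLift x (y₀, w₀ + (p • e₁ + q • e₂))) =
      N - (p ^ 2 + q ^ 2) * (N - ρ) := by
    intro p q
    rw [hN, ← form_add_smul_self g h1 h2 h3 h4 h5, ← hAadd]
    rfl
  have hfut : ∀ p q : ℝ, p ^ 2 + q ^ 2 ≤ 1 →
      chartLift x (y₀, w₀ + (p • e₁ + q • e₂)) ∈ futureTimelike g τ := by
    intro p q hpq
    have hpos : 0 < sqNorm g (chartLift x (y₀, w₀ + (p • e₁ + q • e₂))) := by
      rw [hsq]
      nlinarith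
    refine ⟨hpos, ?_⟩
    -- Both the new vector and `τ` have positive product with `A w₀`: the former because the added
    -- part is orthogonal to `A w₀`.
    refine form_pos_congr g _ (t := A w₀) h0 (τ.timelike _) hpos.le ?_ ?_
    · exact hτ.trans_eq (g.symm _ _ _)
    · have := form_self_add_smul g h1 h2 p q
      rw [← hAadd] at this
      exact this.trans_gt h0
  have hO : IsOpen ((extChartAt (𝓡 4) x).target ×ˢ (univ : Set (EuclideanSpace ℝ (Fin 4)))) :=
    (isOpen_extChartAt_target x).prod isOpen_univ
  have hopen : ∀ B : ℝ, IsOpen (((extChartAt (𝓡 4) x).target ×ˢ univ) ∩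
      chartLift x ⁻¹' (futureTimelike g τ ∩ {v | sqNorm g v < B})) := fun B ↦
    (continuousOn_chartLift x).isOpen_inter_preimage hO
      ((isOpen_futureTimelike g τ).inter (isOpen_lt (continuous_sqNorm g) continuous_const))
  have hcont : Continuous fun r : ℝ × ℝ ↦ (y₀, w₀ + (r.1 • e₁ + r.2 • e₂)) := by fun_prop
  -- Compactness of the disc, and below of its boundary circle, gives one `δ` for all `p` and `q`.
  obtain ⟨δ₀, hδ₀, hsub₀⟩ := (isCompact_disc.image hcont).exists_thickening_subset_open
    (hopen (N + 1)) (by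
      rintro _ ⟨r, hr, rfl⟩
      refine ⟨⟨hy, mem_univ _⟩, hfut _ _ hr, ?_⟩
      have hr' : r.1 ^ 2 + r.2 ^ 2 ≤ 1 := hr
      change sqNorm g _ < _
      rw [hsq]
      nlinarith [sq_nonneg r.1, sq_nonneg r.2])
  have hcirc : IsCompact {r : ℝ × ℝ | r.1 ^ 2 + r.2 ^ 2 = 1} :=
    isCompact_disc.of_isClosed_subset (isClosed_eq (by fun_prop) continuous_const)
      fun r hr ↦ le_of_eq hr
  obtain ⟨δ₁, hδ₁, hsub₁⟩ := (hcirc.image hcont).exists_thickening_subset_open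
    (hopen κ) (by
      rintro _ ⟨r, hr, rfl⟩
      have hr' : r.1 ^ 2 + r.2 ^ 2 = 1 := hr
      refine ⟨⟨hy, mem_univ _⟩, hfut _ _ hr'.le, ?_⟩
      change sqNorm g _ < _
      rw [hsq, hr']
      linarith)
  refine ⟨min δ₀ δ₁, lt_min hδ₀ hδ₁, N + 1, e₁, e₂, fun y w p q hpq hyd hwd ↦ ?_⟩
  have hdist : dist (y, w) (y₀, w₀ + (p • e₁ + q • e₂)) < min δ₀ δ₁ := by
    rw [Prod.dist_eq, dist_eq_norm, dist_eq_norm]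
    exact max_lt hyd hwd
  obtain ⟨hm₁, hm₂, hm₃⟩ := hsub₀ (Metric.mem_thickening_iff.2
    ⟨_, mem_image_of_mem _ (show (p, q) ∈ {r : ℝ × ℝ | r.1 ^ 2 + r.2 ^ 2 ≤ 1} from hpq),
      hdist.trans_le (min_le_left _ _)⟩)
  refine ⟨hm₁.1, hm₂, hm₃, fun hpq' ↦ ?_⟩
  exact (hsub₁ (Metric.mem_thickening_iff.2
    ⟨_, mem_image_of_mem _ (show (p, q) ∈ {r : ℝ × ℝ | r.1 ^ 2 + r.2 ^ 2 = 1} from hpq'),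
      hdist.trans_le (min_le_right _ _)⟩)).2.2

/-! ### Shortening a curve, locally and then globally. -/

/-- Meant for the two end pieces of length `μ`, where the cut-off spoils the almost null bound and
only the crude bound `A` remains. -/
theorem integral_le_of_le_off_ends {f : ℝ → ℝ} {c d μ A B : ℝ} (hμ : 0 ≤ μ) (hcd : 2 * μ ≤ d - c)
    (hf : ContinuousOn f (Icc c d)) (hA : ∀ s ∈ Ioo c d, f s ≤ A) (hB0 : 0 ≤ B)
    (hB : ∀ s ∈ Ioo c d, s ∈ Icc (c + μ) (d - μ) → f s ≤ B) :
    ∫ s in c..d, f s ≤ 2 * μ * A + (d - c) * B := by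
  have hi : ∀ r t, c ≤ r → r ≤ t → t ≤ d → IntervalIntegrable f MeasureTheory.volume r t :=
    fun r t h1 h2 h3 ↦ (hf.mono (Icc_subset_Icc h1 h3)).intervalIntegrable_of_Icc h2
  have hb : ∀ r t K, c ≤ r → r ≤ t → t ≤ d → (∀ s ∈ Ioo r t, f s ≤ K) →
      ∫ s in r..t, f s ≤ (t - r) * K := by
    intro r t K h1 h2 h3 h
    have := intervalIntegral.integral_mono_on_of_le_Ioo h2 (hi r t h1 h2 h3)
      (intervalIntegrable_const (c := K)) h
    simpa using this
  rw [← intervalIntegral.integral_add_adjacent_intervals (b := c + μ)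
    (hi _ _ le_rfl (by linarith) (by linarith)) (hi _ _ (by linarith) (by linarith) le_rfl),
    ← intervalIntegral.integral_add_adjacent_intervals (a := c + μ) (b := d - μ)
    (hi _ _ (by linarith) (by linarith) (by linarith))
    (hi _ _ (by linarith) (by linarith) le_rfl)]
  have k1 := hb c (c + μ) A le_rfl (by linarith) (by linarith)
    fun s hs ↦ hA s ⟨hs.1, by linarith [hs.2]⟩
  have k2 := hb (c + μ) (d - μ) B (by linarith) (by linarith) (by linarith)
    fun s hs ↦ hB s ⟨by linarith [hs.1], by linarith [hs.2]⟩ ⟨hs.1.le, hs.2.le⟩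
  have k3 := hb (d - μ) d A (by linarith) (by linarith) le_rfl
    fun s hs ↦ hA s ⟨by linarith [hs.1], hs.2⟩
  nlinarith [mul_nonneg hμ hB0]

theorem continuousOn_sqrt_sqNorm_velocity (g : LorentzMetric M) {γ : ℝ → M} {J : Set ℝ}
    (hJ : IsOpen J) (hγ : ContMDiffOn 𝓘(ℝ, ℝ) (𝓡 4) ∞ γ J) :
    ContinuousOn (fun s ↦ √(sqNorm g (velocity γ s))) J :=
  Real.continuous_sqrt.comp_continuousOn
    ((continuous_sqNorm g).comp_continuousOn (continuousOn_velocity hJ hγ))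

/-- Replace the curve `σ` on `(c, d)` by its perturbation by `v` in the chart at `x`. -/
theorem exists_perturbed_curve {σ : ℝ → M} {J : Set ℝ} (hJ : IsOpen J)
    (hσ : ContMDiffOn 𝓘(ℝ, ℝ) (𝓡 4) ∞ σ J) (x : M) {u v : ℝ → EuclideanSpace ℝ (Fin 4)} {c d : ℝ}
    (hu : ContDiffOn ℝ ∞ u (Ioo c d)) (hv : ContDiff ℝ ∞ v) (hvs : tsupport v ⊆ Ioo c d)
    (hσu : ∀ s ∈ Ioo c d, (extChartAt (𝓡 4) x).symm (u s) = σ s)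
    (huv : ∀ s ∈ Ioo c d, u s + v s ∈ (extChartAt (𝓡 4) x).target) :
    ∃ ρ : ℝ → M, ContMDiffOn 𝓘(ℝ, ℝ) (𝓡 4) ∞ ρ J ∧ (∀ s ∉ Ioo c d, ρ s = σ s) ∧
      (∀ s ∉ Ioo c d, velocity ρ s = velocity σ s) ∧
      ∀ s ∈ Ioo c d, velocity ρ s = chartLift x (u s + v s, deriv u s + deriv v s) := by
  classical
  let w : ℝ → M := fun s ↦ (extChartAt (𝓡 4) x).symm (u s + v s)
  let ρ : ℝ → M := fun s ↦ if s ∈ Ioo c d then w s else σ s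
  have hin : ∀ s ∈ Ioo c d, ρ =ᶠ[𝓝 s] w := fun s hs ↦ by
    filter_upwards [isOpen_Ioo.mem_nhds hs] with r hr using if_pos hr
  -- As the support of `v` is compactly inside `(c, d)`, the two curves agree near `c` and `d`, so
  -- the gluing is smooth there.
  have hout : ∀ s ∉ Ioo c d, ρ =ᶠ[𝓝 s] σ := fun s hs ↦ by
    filter_upwards [(isClosed_tsupport v).isOpen_compl.mem_nhds fun h ↦ hs (hvs h)] with r hr
    by_cases hr' : r ∈ Ioo c d
    · simp only [ρ, if_pos hr', w, image_eq_zero_of_notMem_tsupport hr, add_zero, hσu r hr']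
    · exact if_neg hr'
  have hus : ∀ s ∈ Ioo c d, ContDiffAt ℝ ∞ u s := fun s hs ↦
    hu.contDiffAt (isOpen_Ioo.mem_nhds hs)
  refine ⟨ρ, fun s hs ↦ ?_, fun s hs ↦ if_neg hs, fun s hs ↦ velocity_congr (hout s hs),
    fun s hs ↦ ?_⟩
  · by_cases h : s ∈ Ioo c d
    · have h1 : ContMDiffAt 𝓘(ℝ, ℝ) 𝓘(ℝ, EuclideanSpace ℝ (Fin 4)) ∞ (fun r ↦ u r + v r) s :=
        ((hus s h).add hv.contDiffAt).contMDiffAt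
      have h2 := (contMDiffOn_extChartAt_symm (I := 𝓡 4) (n := ∞) x).contMDiffAt
        ((isOpen_extChartAt_target x).mem_nhds (huv s h))
      have h3 : ContMDiffAt 𝓘(ℝ, ℝ) (𝓡 4) ∞ w s := ContMDiffAt.comp s h2 h1
      exact (h3.congr_of_eventuallyEq (hin s h)).contMDiffWithinAt
    · exact ((hσ.contMDiffAt (hJ.mem_nhds hs)).congr_of_eventuallyEq (hout s h)).contMDiffWithinAt
  · have hd := (hus s hs).differentiableAt (by simp)
    have hd' := hv.differentiable (by simp) s
    rw [velocity_congr (hin s hs), ← deriv_fun_add hd hd']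
    exact velocity_extChartAt_symm_comp x (u := fun r ↦ u r + v r) (huv s hs) (hd.add hd')

/-- Near a parameter where the curve is future directed timelike, it can be made almost null on
any small interval without changing it outside that interval. -/
theorem exists_local_shortening (g : LorentzMetric M) (τ : TimelikeField g) {γ : ℝ → M}
    {J : Set ℝ} (hJ : IsOpen J) (hγ : ContMDiffOn 𝓘(ℝ, ℝ) (𝓡 4) ∞ γ J) {t : ℝ} (ht : t ∈ J)
    (hF : velocity γ t ∈ futureTimelike g τ) {η : ℝ} (hη : 0 < η) :
    ∃ U : Set ℝ, IsOpen U ∧ t ∈ U ∧ ∀ c d, c < d → Icc c d ⊆ U → ∀ σ : ℝ → M,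
      ContMDiffOn 𝓘(ℝ, ℝ) (𝓡 4) ∞ σ J → (∀ s ∈ Icc c d, σ s = γ s) →
      ∃ ρ : ℝ → M, ContMDiffOn 𝓘(ℝ, ℝ) (𝓡 4) ∞ ρ J ∧ (∀ s ∉ Ioo c d, ρ s = σ s) ∧
        (∀ s ∉ Ioo c d, velocity ρ s = velocity σ s) ∧
        (∀ s ∈ Ioo c d, velocity ρ s ∈ futureTimelike g τ) ∧
        ∫ s in c..d, √(sqNorm g (velocity ρ s)) ≤ η * (d - c) := by
  set φ := extChartAt (𝓡 4) (γ t)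
  let u : ℝ → EuclideanSpace ℝ (Fin 4) := fun s ↦ φ (γ s)
  have hJ' : IsOpen (J ∩ γ ⁻¹' φ.source) :=
    hγ.continuousOn.isOpen_inter_preimage hJ (isOpen_extChartAt_source _)
  have htJ : t ∈ J ∩ γ ⁻¹' φ.source := ⟨ht, mem_extChartAt_source _⟩
  have hu : ContDiffOn ℝ ∞ u (J ∩ γ ⁻¹' φ.source) := by
    rw [← contMDiffOn_iff_contDiffOn]
    have h1 := contMDiffOn_extChartAt (I := 𝓡 4) (n := ∞) (x := γ t)
    refine h1.comp (hγ.mono inter_subset_left) fun s hs ↦ ?_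
    rw [← extChartAt_source (𝓡 4)]
    exact hs.2
  have hut := (hu.contDiffAt (hJ'.mem_nhds htJ)).differentiableAt (by simp)
  have htar : u t ∈ φ.target := φ.map_source htJ.2
  have hF' : chartLift (γ t) (u t, deriv u t) ∈ futureTimelike g τ := by
    rw [← velocity_extChartAt_symm_comp (γ t) htar hut]
    refine (velocity_congr ?_ : _ = velocity γ t) ▸ hF
    filter_upwards [hJ'.mem_nhds htJ] with s hs using φ.left_inv hs.2
  obtain ⟨δ, hδ, C, e₁, e₂, hC⟩ :=
    exists_disc_chartLift g τ (γ t) htar hF' (κ := (η / 2) ^ 2) (by positivity)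
  have hcu : ContinuousOn (fun s ↦ (u s, deriv u s)) (J ∩ γ ⁻¹' φ.source) :=
    hu.continuousOn.prodMk (hu.continuousOn_deriv_of_isOpen hJ' (by simp))
  refine ⟨_, hcu.isOpen_inter_preimage hJ' (Metric.isOpen_ball (x := (u t, deriv u t))
    (ε := δ / 2)), ⟨htJ, Metric.mem_ball_self (by positivity)⟩, fun c d hcd hU σ hσ hσγ ↦ ?_⟩
  have hdc : 0 < d - c := by linarith
  -- The ends contribute at most `2 * μ * √C`, half of the allowance `η * (d - c)`; the middle,
  -- where the speed is below `η / 2`, uses the other half.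
  obtain ⟨μ, hμ, hμ1, hμ2⟩ : ∃ μ : ℝ, 0 < μ ∧ 2 * μ < d - c ∧ 2 * μ * √C ≤ η / 2 * (d - c) := by
    have hK : 0 < √C + 1 := by positivity
    refine ⟨min ((d - c) / 4) (η * (d - c) / (4 * (√C + 1))), by positivity, ?_, ?_⟩
    · linarith [min_le_left ((d - c) / 4) (η * (d - c) / (4 * (√C + 1)))]
    · have h1 := min_le_right ((d - c) / 4) (η * (d - c) / (4 * (√C + 1)))
      rw [le_div_iff₀ (by positivity)] at h1
      have h2 : 0 ≤ min ((d - c) / 4) (η * (d - c) / (4 * (√C + 1))) := by positivity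
      nlinarith
  obtain ⟨v, hv, hvs, p, q, hpq⟩ := exists_rapid_oscillation e₁ e₂ hμ hμ1 (half_pos hδ)
  have hIoo : ∀ s ∈ Ioo c d, (s ∈ J ∩ γ ⁻¹' φ.source) ∧ ‖u s - u t‖ < δ / 2 ∧
      ‖deriv u s - deriv u t‖ < δ / 2 := by
    intro s hs
    obtain ⟨h1, h2⟩ := hU (Ioo_subset_Icc_self hs)
    rw [mem_preimage, Metric.mem_ball, Prod.dist_eq, max_lt_iff, dist_eq_norm, dist_eq_norm] at h2
    exact ⟨h1, h2⟩
  have hres : ∀ s ∈ Ioo c d, _ := fun s hs ↦ hC (u s + v s) (deriv u s + deriv v s) (p s) (q s)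
    (hpq s).1 (by
      have := norm_add_le (u s - u t) (v s)
      rw [add_sub_right_comm]
      linarith [(hIoo s hs).2.1, (hpq s).2.2.1]) (by
      have := norm_add_le (deriv u s - deriv u t) (deriv v s - (p s • e₁ + q s • e₂))
      rw [add_sub_add_comm]
      linarith [(hIoo s hs).2.2, (hpq s).2.2.2])
  obtain ⟨ρ, hρ, hρ1, hρ2, hρ3⟩ := exists_perturbed_curve hJ hσ (γ t)
    (hu.mono fun s hs ↦ (hIoo s hs).1) hv hvs
    (fun s hs ↦ (φ.left_inv (hIoo s hs).1.2).trans (hσγ s (Ioo_subset_Icc_self hs)).symm)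
    fun s hs ↦ (hres s hs).1
  refine ⟨ρ, hρ, hρ1, hρ2, fun s hs ↦ hρ3 s hs ▸ (hres s hs).2.1, ?_⟩
  have hcont : ContinuousOn (fun s ↦ √(sqNorm g (velocity ρ s))) (Icc c d) :=
    (continuousOn_sqrt_sqNorm_velocity g hJ hρ).mono fun s hs ↦ (hU hs).1.1
  refine (integral_le_of_le_off_ends (A := √C) (B := η / 2) hμ.le hμ1.le hcont ?_ (by positivity)
    ?_).trans (by linarith)
  · intro s hs
    simp only [hρ3 s hs]
    exact Real.sqrt_le_sqrt (hres s hs).2.2.1.le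
  · intro s hs hs'
    simp only [hρ3 s hs]
    exact Real.sqrt_le_iff.2 ⟨by positivity, ((hres s hs).2.2.2 ((hpq s).2.1 hs')).le⟩

/-- The neighbourhoods given by `exists_local_shortening` depend only on `γ`, so a finite
subdivision subordinate to them can be fixed in advance and treated piece by piece. The bounds add
up because each is proportional to the length of its piece. -/
theorem exists_shortening (g : LorentzMetric M) (τ : TimelikeField g) {γ : ℝ → M}
    {J : Set ℝ} (hJ : IsOpen J) (hγ : ContMDiffOn 𝓘(ℝ, ℝ) (𝓡 4) ∞ γ J) {a b : ℝ} (hab : a ≤ b)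
    (hsub : Icc a b ⊆ J) (hF : ∀ s ∈ Icc a b, velocity γ s ∈ futureTimelike g τ) {η : ℝ}
    (hη : 0 < η) : ∃ σ : ℝ → M, ContMDiffOn 𝓘(ℝ, ℝ) (𝓡 4) ∞ σ J ∧ σ a = γ a ∧ σ b = γ b ∧
      (∀ s ∈ Icc a b, velocity σ s ∈ futureTimelike g τ) ∧
      ∫ s in a..b, √(sqNorm g (velocity σ s)) ≤ η * (b - a) := by
  choose U hUo hUm hU using fun t : Icc a b ↦
    exists_local_shortening g τ hJ hγ (hsub t.2) (hF t t.2) hη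
  obtain ⟨t, ht0, htm, ⟨m, hm⟩, ht⟩ := exists_monotone_Icc_subset_open_cover_Icc hab
    (fun i ↦ (hUo i).preimage continuous_subtype_val)
    (fun s _ ↦ mem_iUnion.2 ⟨s, hUm s⟩)
  -- Agreement with `γ` from `t n` onwards keeps the next piece unmodified, as the local step
  -- requires.
  have key : ∀ n, ∃ σ : ℝ → M, ContMDiffOn 𝓘(ℝ, ℝ) (𝓡 4) ∞ σ J ∧ σ a = γ a ∧
      (∀ s, (t n : ℝ) ≤ s → σ s = γ s) ∧
      (∀ s ∈ Icc a b, velocity σ s ∈ futureTimelike g τ) ∧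
      ∫ s in a..t n, √(sqNorm g (velocity σ s)) ≤ η * (t n - a) := by
    intro n
    induction n with
    | zero => exact ⟨γ, hγ, rfl, fun s _ ↦ rfl, hF, by simp [ht0]⟩
    | succ n ih =>
      obtain ⟨σ, hσ, hσa, hσγ, hσF, hσi⟩ := ih
      -- The subdivision is only weakly monotone; repeated points need no change.
      have hle : (t n : ℝ) ≤ t (n + 1) := htm n.le_succ
      rcases hle.eq_or_lt with heq | hlt
      · exact ⟨σ, hσ, hσa, heq ▸ hσγ, hσF, heq ▸ hσi⟩
      obtain ⟨i, hi⟩ := ht n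
      obtain ⟨ρ, hρ, hρ1, hρ2, hρ3, hρi⟩ := hU i (t n) (t (n + 1)) hlt (fun s hs ↦
        hi (show (⟨s, (t n).2.1.trans hs.1, hs.2.trans (t (n + 1)).2.2⟩ : Icc a b) ∈ _ from hs))
        σ hσ fun s hs ↦ hσγ s hs.1
      refine ⟨ρ, hρ, ?_, fun s hs ↦ ?_, fun s hs ↦ ?_, ?_⟩
      · rw [hρ1 a fun h ↦ (h.1.trans_le (t n).2.1).false, hσa]
      · rw [hρ1 s fun h ↦ (h.2.trans_le hs).false, hσγ s (hle.trans hs)]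
      · by_cases h : s ∈ Ioo (t n : ℝ) (t (n + 1))
        · exact hρ3 s h
        · exact hρ2 s h ▸ hσF s hs
      · have hc := (continuousOn_sqrt_sqNorm_velocity g hJ hρ).mono hsub
        rw [← intervalIntegral.integral_add_adjacent_intervals (b := (t n : ℝ))
          ((hc.mono (Icc_subset_Icc le_rfl (t n).2.2)).intervalIntegrable_of_Icc (t n).2.1)
          ((hc.mono (Icc_subset_Icc (t n).2.1 (t (n + 1)).2.2)).intervalIntegrable_of_Icc hle)]
        have heq : ∫ s in a..t n, √(sqNorm g (velocity ρ s)) =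
            ∫ s in a..t n, √(sqNorm g (velocity σ s)) := by
          refine intervalIntegral.integral_congr fun s hs ↦ ?_
          rw [uIcc_of_le (t n).2.1] at hs
          simp only [hρ2 s fun h ↦ (h.1.trans_le hs.2).false]
        rw [heq]
        linarith
  obtain ⟨σ, hσ, hσa, hσγ, hσF, hσi⟩ := key m
  rw [hm m le_rfl] at hσγ hσi
  exact ⟨σ, hσ, hσa, hσγ b le_rfl, hσF, hσi⟩

/-! ### Proper time and the conclusion. -/

theorem isFutureDirected_of_mem_futureTimelike (g : LorentzMetric M) (τ : TimelikeField g) {x : M}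
    {v : TangentSpace (𝓡 4) x}
    (h : (⟨x, v⟩ : TangentBundle (𝓡 4) M) ∈ futureTimelike g τ) :
    IsFutureDirected g (Quotient.mk (coOriented g) τ) x v :=
  (isFutureDirected_mk_iff g τ x v).2 ⟨h.1.le, h.2⟩

/-- Passing to a smooth extension turns one-sided tangents at the endpoints into ordinary
velocities, whose continuity is known. -/
theorem properTime_eq_integral_velocity (g : LorentzMetric M) {γ σ : ℝ → M} {J : Set ℝ} {a b : ℝ}
    (hab : a < b) (hJ : IsOpen J) (hsub : Icc a b ⊆ J) (hσ : ContMDiffOn 𝓘(ℝ, ℝ) (𝓡 4) ∞ σ J)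
    (h : EqOn σ γ (Icc a b)) :
    properTime g γ a b = ∫ s in a..b, √(sqNorm g (velocity σ s)) := by
  refine intervalIntegral.integral_congr fun s hs ↦ ?_
  rw [uIcc_of_le hab.le] at hs
  simp only [← mk_tangent_eq_velocity hab hJ hsub hσ h hs]
  rfl

/-- Timelike curves have positive length. -/
theorem IsTimelikeCurve.properTime_pos {g : LorentzMetric M} {γ : ℝ → M} {a b : ℝ}
    (h : IsTimelikeCurve g γ a b) : 0 < properTime g γ a b := by
  obtain ⟨hab, ⟨J, hJ, -, hsub, σ, hσ, hσγ⟩, ht⟩ := h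
  rw [properTime_eq_integral_velocity g hab hJ hsub hσ hσγ]
  refine intervalIntegral.intervalIntegral_pos_of_pos_on
    (((continuousOn_sqrt_sqNorm_velocity g hJ hσ).mono hsub).intervalIntegrable_of_Icc hab.le)
    (fun s hs ↦ Real.sqrt_pos.2 ?_) hab
  rw [← mk_tangent_eq_velocity hab hJ hsub hσ hσγ (Ioo_subset_Icc_self hs)]
  exact ht s (Ioo_subset_Icc_self hs)

/-- Chronologically related points are joined by arbitrarily short timelike curves. -/
theorem Chronological.exists_properTime_lt {g : LorentzMetric M} {T : TemporalOrientation g}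
    {p q : M} (hpq : Chronological g T p q) {ε : ℝ} (hε : 0 < ε) :
    ∃ (γ : ℝ → M) (a b : ℝ),
      IsFutureTimelikeCurveFromTo g T p q γ a b ∧ properTime g γ a b < ε := by
  obtain ⟨γ, a, b, ⟨⟨⟨hab, ⟨J, hJ, hJc, hsub, σ, hσ, hσγ⟩, ht⟩, hf⟩, rfl, rfl⟩⟩ := hpq
  obtain ⟨τ, rfl⟩ := Quotient.exists_rep T
  have hba : 0 < b - a := sub_pos.2 hab
  obtain ⟨ρ, hρ, hρa, hρb, hρF, hρi⟩ := exists_shortening g τ hJ hσ hab.le hsub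
    (fun s hs ↦ by
      rw [← mk_tangent_eq_velocity hab hJ hsub hσ hσγ hs]
      exact ⟨ht s hs, (hf s hs).2.2 τ rfl⟩) (η := ε / (2 * (b - a))) (by positivity)
  have hmem : ∀ s ∈ Icc a b, (⟨ρ s, tangent ρ (Icc a b) s⟩ : TangentBundle (𝓡 4) M) ∈
      futureTimelike g τ := fun s hs ↦ by
    rw [mk_tangent_eq_velocity hab hJ hsub hρ (eqOn_refl _ _) hs]
    exact hρF s hs
  refine ⟨ρ, a, b, ⟨⟨⟨hab, ⟨J, hJ, hJc, hsub, ρ, hρ, eqOn_refl _ _⟩, fun s hs ↦ (hmem s hs).1⟩,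
    fun s hs ↦ isFutureDirected_of_mem_futureTimelike g τ (hmem s hs)⟩,
    hρa.trans (hσγ (left_mem_Icc.2 hab.le)), hρb.trans (hσγ (right_mem_Icc.2 hab.le))⟩, ?_⟩
  rw [properTime_eq_integral_velocity g hab hJ hsub hρ (eqOn_refl _ _)]
  refine hρi.trans_lt ?_
  rw [div_mul_eq_mul_div, div_lt_iff₀ (by positivity)]
  nlinarith [mul_pos hε hba]

end Spacetime

theorem mainTheorem11 {M : Type*} [TopologicalSpace M] [T2Space M] [ConnectedSpace M]
    [ChartedSpace (EuclideanSpace ℝ (Fin 4)) M] [IsManifold (𝓡 4) ∞ M]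
    (g : Spacetime.LorentzMetric M) (T : Spacetime.TemporalOrientation g) (p q : M)
    (hpq : Spacetime.Chronological g T p q) :
    (∀ ε : ℝ, 0 < ε → ∃ (γ : ℝ → M) (a b : ℝ),
      Spacetime.IsFutureTimelikeCurveFromTo g T p q γ a b ∧ Spacetime.properTime g γ a b < ε) ∧
    (¬ ∃ (γ : ℝ → M) (a b : ℝ),
      Spacetime.IsFutureTimelikeCurveFromTo g T p q γ a b ∧ Spacetime.properTime g γ a b = 0) ∧
    (∀ (γ : ℝ → M) (a b : ℝ),
      Spacetime.IsTimelikeCurve g γ a b → Spacetime.properTime g γ a b ≠ 0) :=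
  ⟨fun _ hε ↦ hpq.exists_properTime_lt hε,
    fun ⟨_, _, _, h, h0⟩ ↦ h.1.1.properTime_pos.ne' h0, fun _ _ _ h ↦ h.properTime_pos.ne'⟩
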